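/- Let $Q$ be a qubit with orthonormal basis $\{|0\rangle,|1\rangle\}$, let $E_1$ and $E_2$ be arbitrary quantum systems (complex Hilbert spaces of any dimension), and let $\rho$ be an arbitrary density operator on $Q\otimes E_1\otimes E_2$. For an orthonormal basis $X=\{|x_0\rangle,|x_1\rangle\}$ of $Q$ and $i\in\{1,2\}$, let $$p_{\mathrm{guess}}(X|E_i)=\sup_{M_0,M_1\ge 0,\ M_0+M_1=1}\ \sum_{j=0,1}\operatorname{Tr}\bigl[(|x_j\rangle\langle x_j|\otimes M_j)\,\rho_{QE_i}\bigr]$$ be the probability of correctly guessing the outcome of measuring $Q$ in the basis $X$, given the optimal measurement on $E_i$; here $\rho_{QE_i}$ is the reduced state of $\rho$ and the supremum is over two-outcome POVMs on $E_i$. Let $Z=\{|0\rangle,|1\rangle\}$ be the which-path observable, and let $XY$ denote the set of which-phase observables $W_{\phi_0}=\{|w_+\rangle,|w_-\rangle\}$, $|w_\pm\rangle=\tfrac1{\sqrt2}(|0\rangle\pm e^{i\phi_0}|1\rangle)$, $\phi_0\in\mathbb R$. Put $$\mathcal D_g:=2\,p_{\mathrm{guess}}(Z|E_1)-1,\qquad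 \mathcal V_g:=\max_{W\in XY}\bigl[2\,p_{\mathrm{guess}}(W|E_2)-1\bigr].$$ Then the maximum defining $\mathcal V_g$ is attained, and $$\mathcal D_g^2+\mathcal V_g^2\le 1 .$$ -/

import Mathlib

open scoped TensorProduct InnerProductSpace

noncomputable section

namespace WaveParticle

/-- The state space of a qubit. -/
abbrev Qubit : Type := EuclideanSpace ℂ (Fin 2)

/-- The Hilbert space of the tripartite system `Q E₁ E₂`: the Hilbert space tensor product of the
qubit with the two side systems, that is, the completion of the algebraic tensor product. -/
def Tripartite (E₁ E₂ : Type*)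
    [NormedAddCommGroup E₁] [InnerProductSpace ℂ E₁]
    [NormedAddCommGroup E₂] [InnerProductSpace ℂ E₂] : Type _ :=
  UniformSpace.Completion (Qubit ⊗[ℂ] (E₁ ⊗[ℂ] E₂))

namespace Tripartite

variable (E₁ E₂ : Type*)
  [NormedAddCommGroup E₁] [InnerProductSpace ℂ E₁]
  [NormedAddCommGroup E₂] [InnerProductSpace ℂ E₂]

instance : NormedAddCommGroup (Tripartite E₁ E₂) :=
  inferInstanceAs (NormedAddCommGroup (UniformSpace.Completion (Qubit ⊗[ℂ] (E₁ ⊗[ℂ] E₂))))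

instance : InnerProductSpace ℂ (Tripartite E₁ E₂) :=
  inferInstanceAs (InnerProductSpace ℂ (UniformSpace.Completion (Qubit ⊗[ℂ] (E₁ ⊗[ℂ] E₂))))

instance : CompleteSpace (Tripartite E₁ E₂) :=
  inferInstanceAs (CompleteSpace (UniformSpace.Completion (Qubit ⊗[ℂ] (E₁ ⊗[ℂ] E₂))))

end Tripartite

/-- The trace `∑ᵢ ⟪eᵢ, T eᵢ⟫` of a trace class operator, computed in some orthonormal basis of the
Hilbert space (for trace class operators the value does not depend on the basis). -/
def opTrace {H : Type*} [NormedAddCommGroup H] [InnerProductSpace ℂ H] [CompleteSpace H]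
    (T : H →L[ℂ] H) : ℂ :=
  ∑' i : (exists_hilbertBasis ℂ H).choose,
    ⟪(exists_hilbertBasis ℂ H).choose_spec.choose i,
      T ((exists_hilbertBasis ℂ H).choose_spec.choose i)⟫_ℂ

/-- A density operator: a positive operator of trace one. (A sum that does not converge has the
value `0` here, so a positive operator with `opTrace ρ = 1` is automatically trace class.) -/
structure IsDensityOperator {H : Type*} [NormedAddCommGroup H] [InnerProductSpace ℂ H]
    [CompleteSpace H] (ρ : H →L[ℂ] H) : Prop where
  isPositive : ρ.IsPositive
  trace_eq_one : opTrace ρ = 1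

/-- A two-outcome measurement (POVM) `{M₀, M₁}`: `M₀, M₁ ≥ 0` and `M₀ + M₁ = 1`. -/
structure BinaryPOVM (E : Type*) [NormedAddCommGroup E] [InnerProductSpace ℂ E] where
  effect : Fin 2 → (E →L[ℂ] E)
  isPositive : ∀ j, (effect j).IsPositive
  sum_eq_one : effect 0 + effect 1 = 1

/-- The operator `|x⟩⟨x|` on the qubit. -/
def ketbra (x : Qubit) : Qubit →L[ℂ] Qubit := InnerProductSpace.rankOne ℂ x x

/-- The which-path basis `Z = {|0⟩, |1⟩}` of the qubit. -/
def whichPath (j : Fin 2) : Qubit := EuclideanSpace.single j 1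

/-- The which-phase basis `W = {|w₊⟩, |w₋⟩}`, `|w_±⟩ = (|0⟩ ± e^{iφ₀}|1⟩)/√2`, an orthonormal basis
in the `XY` plane of the Bloch sphere; `|w₊⟩` has index `0` and `|w₋⟩` has index `1`. -/
def whichPhase (φ₀ : ℝ) (j : Fin 2) : Qubit :=
  ((1 / Real.sqrt 2 : ℝ) : ℂ) •
    (whichPath 0 + ((-1) ^ (j : ℕ) * Complex.exp (Complex.I * φ₀)) • whichPath 1)

section Tripartite

variable {E₁ E₂ : Type*}
  [NormedAddCommGroup E₁] [InnerProductSpace ℂ E₁]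
  [NormedAddCommGroup E₂] [InnerProductSpace ℂ E₂]

/-- The canonical embedding of the algebraic tensor product into its completion. -/
def ofAlgebraic (t : Qubit ⊗[ℂ] (E₁ ⊗[ℂ] E₂)) : Tripartite E₁ E₂ :=
  (t : UniformSpace.Completion (Qubit ⊗[ℂ] (E₁ ⊗[ℂ] E₂)))

/-- The operator `A ⊗ B ⊗ C` on `Q E₁ E₂`. -/
def tensorOp (A : Qubit →L[ℂ] Qubit) (B : E₁ →L[ℂ] E₁) (C : E₂ →L[ℂ] E₂) :
    Tripartite E₁ E₂ →L[ℂ] Tripartite E₁ E₂ :=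
  (TensorProduct.mapL A (TensorProduct.mapL B C)).completion

theorem denseRange_ofAlgebraic : DenseRange (ofAlgebraic (E₁ := E₁) (E₂ := E₂)) :=
  UniformSpace.Completion.denseRange_coe

theorem inner_ofAlgebraic (s t : Qubit ⊗[ℂ] (E₁ ⊗[ℂ] E₂)) :
    ⟪ofAlgebraic s, ofAlgebraic t⟫_ℂ = ⟪s, t⟫_ℂ :=
  UniformSpace.Completion.inner_coe s t

theorem tensorOp_tmul (A : Qubit →L[ℂ] Qubit) (B : E₁ →L[ℂ] E₁) (C : E₂ →L[ℂ] E₂)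
    (q : Qubit) (x : E₁) (y : E₂) :
    tensorOp A B C (ofAlgebraic (q ⊗ₜ[ℂ] (x ⊗ₜ[ℂ] y))) =
      ofAlgebraic (A q ⊗ₜ[ℂ] (B x ⊗ₜ[ℂ] C y)) :=
  ContinuousLinearMap.completion_apply_coe _ _

/-- In the state `ρ` of `Q E₁ E₂`, the qubit is measured in the basis `X` and `E₁` with the POVM
`M`: the probability `∑ⱼ Tr[(|xⱼ⟩⟨xⱼ| ⊗ Mⱼ ⊗ 1) ρ]` that the two outcomes agree, that is, that the
outcome of `M` is a correct guess of the value of `X`. -/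
def winProb₁ (ρ : Tripartite E₁ E₂ →L[ℂ] Tripartite E₁ E₂) (X : Fin 2 → Qubit)
    (M : BinaryPOVM E₁) : ℝ :=
  ∑ j : Fin 2, (opTrace (tensorOp (ketbra (X j)) (M.effect j) 1 * ρ)).re

/-- The same with a measurement of `E₂`: `∑ⱼ Tr[(|xⱼ⟩⟨xⱼ| ⊗ 1 ⊗ Mⱼ) ρ]`. -/
def winProb₂ (ρ : Tripartite E₁ E₂ →L[ℂ] Tripartite E₁ E₂) (X : Fin 2 → Qubit)
    (M : BinaryPOVM E₂) : ℝ :=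
  ∑ j : Fin 2, (opTrace (tensorOp (ketbra (X j)) 1 (M.effect j) * ρ)).re

/-- The guessing probability `p_guess(X|E₁)`: the probability of guessing `X` correctly with the
optimal measurement on `E₁`. -/
def pGuess₁ (ρ : Tripartite E₁ E₂ →L[ℂ] Tripartite E₁ E₂) (X : Fin 2 → Qubit) : ℝ :=
  ⨆ M : BinaryPOVM E₁, winProb₁ ρ X M

/-- The guessing probability `p_guess(X|E₂)`. -/
def pGuess₂ (ρ : Tripartite E₁ E₂ →L[ℂ] Tripartite E₁ E₂) (X : Fin 2 → Qubit) : ℝ :=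
  ⨆ M : BinaryPOVM E₂, winProb₂ ρ X M

/-- The measure of particle behaviour `D_g = 2 p_guess(Z|E₁) - 1`. -/
def distinguishability (ρ : Tripartite E₁ E₂ →L[ℂ] Tripartite E₁ E₂) : ℝ :=
  2 * pGuess₁ ρ whichPath - 1

/-- The measure of wave behaviour `V_g = max_{W ∈ XY} [2 p_guess(W|E₂) - 1]`. -/
def visibility (ρ : Tripartite E₁ E₂ →L[ℂ] Tripartite E₁ E₂) : ℝ :=
  ⨆ φ₀ : ℝ, (2 * pGuess₂ ρ (whichPhase φ₀) - 1)

end Tripartite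

end WaveParticle

end

noncomputable section

namespace WaveParticle

/-! Twice a guessing probability minus one is the supremum over POVMs of the expectation of `S = Z ⊗
(M₀ - M₁) ⊗ 1`, respectively `T = W ⊗ 1 ⊗ (N₀ - N₁)`, where `Z` and `W` are the `±1` observables of
the two bases (`two_mul_winProb₁_sub_one`, `two_mul_winProb₂_sub_one`). Both are symmetric
contractions. As `Z` and `W` anticommute while `M` and `N` act on different systems, `S` and `T`
anticommute, hence `‖a S + b T‖ ≤ √(a² + b²)` for real `a`, `b`
(`norm_smul_add_smul_le_of_anticommute`). Expectation values are bounded by the norm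
(`IsDensityOperator.exists_state`), so `a D + b V ≤ √(a² + b²)` for `a, b ≥ 0`; the choice `a = D`,
`b = V` gives the inequality.

The maximum over the phase is attained because the bias is continuous and periodic in it. -/

theorem hasSum_norm_inner_sq {ι H : Type*} [NormedAddCommGroup H] [InnerProductSpace ℂ H]
    (e : HilbertBasis ι ℂ H) (x : H) :
    HasSum (fun i => ‖⟪e i, x⟫_ℂ‖ ^ 2) (‖x‖ ^ 2) := by
  have h := e.hasSum_inner_mul_inner x x
  rw [inner_self_eq_norm_sq_to_K] at h
  have h' := Complex.hasSum_re h
  convert h' using 1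
  · funext i
    rw [← inner_conj_symm x, RCLike.conj_mul]
    norm_cast
  · norm_cast

/-! ### Trace and density operators: from `opTrace` to a state on bounded operators. -/

section Trace

variable {H : Type*} [NormedAddCommGroup H] [InnerProductSpace ℂ H] [CompleteSpace H]

/-- For Hilbert–Schmidt operators `A` and `B` the two ways of computing `Tr(A B)` agree. -/
theorem hasSum_inner_comp_of_summable_norm_sq {ι : Type*} (e : HilbertBasis ι ℂ H)
    (A B : H →L[ℂ] H) (hA : Summable fun i => ‖A (e i)‖ ^ 2)
    (hB : Summable fun i => ‖B.adjoint (e i)‖ ^ 2) :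
    HasSum (fun i => ⟪B.adjoint (e i), A (e i)⟫_ℂ) (∑' i, ⟪e i, A (B (e i))⟫_ℂ) := by
  -- By Parseval, the matrix entries of a Hilbert–Schmidt operator are square summable over `ι × ι`.
  have key (C : H →L[ℂ] H) (hC : Summable fun i => ‖C (e i)‖ ^ 2) :
      Summable fun p : ι × ι => ‖⟪e p.2, C (e p.1)⟫_ℂ‖ ^ 2 := by
    have h0 : (0 : ι × ι → ℝ) ≤ fun p => ‖⟪e p.2, C (e p.1)⟫_ℂ‖ ^ 2 := fun _ => sq_nonneg _
    refine (summable_prod_of_nonneg h0).mpr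
      ⟨fun i => (hasSum_norm_inner_sq e (C (e i))).summable, ?_⟩
    convert hC using 1
    funext i
    exact (hasSum_norm_inner_sq e (C (e i))).tsum_eq
  have hsum : Summable fun p : ι × ι =>
      ⟪B.adjoint (e p.1), e p.2⟫_ℂ * ⟪e p.2, A (e p.1)⟫_ℂ := by
    refine Summable.of_norm_bounded ((key A hA).add (key _ hB)) fun p => ?_
    rw [norm_mul, norm_inner_symm]
    nlinarith [sq_nonneg (‖⟪e p.2, A (e p.1)⟫_ℂ‖ - ‖⟪e p.2, B.adjoint (e p.1)⟫_ℂ‖),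
      sq_nonneg ‖⟪e p.2, A (e p.1)⟫_ℂ‖, sq_nonneg ‖⟪e p.2, B.adjoint (e p.1)⟫_ℂ‖]
  have h₁ : HasSum (fun i => ⟪B.adjoint (e i), A (e i)⟫_ℂ) (∑' p : ι × ι,
      ⟪B.adjoint (e p.1), e p.2⟫_ℂ * ⟪e p.2, A (e p.1)⟫_ℂ) :=
    hsum.hasSum.prod_fiberwise fun i => e.hasSum_inner_mul_inner (B.adjoint (e i)) (A (e i))
  -- Absolute summability lets the double sum be taken in the other order, which yields the diagonal
  -- of `A B`.
  have hswap : HasSum (fun p : ι × ι => ⟪B.adjoint (e p.2), e p.1⟫_ℂ * ⟪e p.1, A (e p.2)⟫_ℂ)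
      (∑' p : ι × ι, ⟪B.adjoint (e p.1), e p.2⟫_ℂ * ⟪e p.2, A (e p.1)⟫_ℂ) :=
    (Equiv.prodComm ι ι).hasSum_iff.mpr hsum.hasSum
  have h₂ : HasSum (fun i => ⟪e i, A (B (e i))⟫_ℂ) (∑' p : ι × ι,
      ⟪B.adjoint (e p.1), e p.2⟫_ℂ * ⟪e p.2, A (e p.1)⟫_ℂ) := by
    refine hswap.prod_fiberwise fun i => ?_
    have h := e.hasSum_inner_mul_inner (A.adjoint (e i)) (B (e i))
    simp only [ContinuousLinearMap.adjoint_inner_left] at h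
    have hc : (fun j => ⟪B.adjoint (e j), e i⟫_ℂ * ⟪e i, A (e j)⟫_ℂ) =
        fun j => ⟪e i, A (e j)⟫_ℂ * ⟪e j, B (e i)⟫_ℂ := by
      funext j
      rw [ContinuousLinearMap.adjoint_inner_left, mul_comm]
    simp only [hc]
    exact h
  rw [h₂.tsum_eq]
  exact h₁

/-- A density operator is a mixture of vector states. -/
theorem IsDensityOperator.exists_hasSum {ρ : H →L[ℂ] H} (hρ : IsDensityOperator ρ) :
    ∃ (s : Set H) (v : s → H), HasSum (fun i => ‖v i‖ ^ 2) 1 ∧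
      ∀ T : H →L[ℂ] H, HasSum (fun i => ⟪v i, T (v i)⟫_ℂ) (opTrace (T * ρ)) := by
  set e := (exists_hilbertBasis ℂ H).choose_spec.choose
  have hpos : 0 ≤ ρ := ρ.nonneg_iff_isPositive.mpr hρ.isPositive
  set S := CFC.sqrt ρ
  have hSS : S * S = ρ := CFC.sqrt_mul_sqrt_self ρ
  have hSa : S.adjoint = S := by
    have : IsSelfAdjoint S := (CFC.sqrt_nonneg ρ).isSelfAdjoint
    exact this
  have htr : (fun i => ⟪e i, ρ (e i)⟫_ℂ) = fun i => ((‖S (e i)‖ ^ 2 : ℝ) : ℂ) := by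
    funext i
    rw [← hSS, mul_apply_eq_comp, ← ContinuousLinearMap.adjoint_inner_left, hSa,
      inner_self_eq_norm_sq_to_K]
    norm_cast
  have h1 : ∑' i, ((‖S (e i)‖ ^ 2 : ℝ) : ℂ) = 1 := by
    rw [← htr]; exact hρ.trace_eq_one
  -- A divergent `tsum` is `0`, so trace one forces convergence.
  have hs : Summable fun i => ‖S (e i)‖ ^ 2 := by
    by_contra h
    rw [tsum_eq_zero_of_not_summable (by rwa [Complex.summable_ofReal])] at h1
    exact zero_ne_one h1
  refine ⟨_, fun i => S (e i), ?_, fun T => ?_⟩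
  · have := hs.hasSum
    rw [← Complex.ofReal_tsum] at h1
    rwa [Complex.ofReal_eq_one.mp h1] at this
  -- Cyclicity for the factorization `T ρ = (T √ρ) √ρ` into Hilbert–Schmidt operators; the vectors
  -- of the mixture are `√ρ eᵢ`.
  · have h := hasSum_inner_comp_of_summable_norm_sq e (T * S) S ?_ (by rwa [hSa])
    · rw [hSa] at h
      rw [opTrace, ← hSS]
      exact h
    · refine Summable.of_nonneg_of_le (fun _ => by positivity) (fun i => ?_)
        (hs.mul_left (‖T‖ ^ 2))
      rw [← mul_pow]
      gcongr
      exact T.le_opNorm _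

/-- The expectation values in a density operator form a state on the bounded operators. -/
theorem IsDensityOperator.exists_state {ρ : H →L[ℂ] H} (hρ : IsDensityOperator ρ) :
    ∃ ω : (H →L[ℂ] H) →ₗ[ℝ] ℝ, (∀ T, (opTrace (T * ρ)).re = ω T) ∧ (∀ T, ω T ≤ ‖T‖) ∧
      ω 1 = 1 := by
  obtain ⟨s, v, hv, h⟩ := hρ.exists_hasSum
  have hre (T : H →L[ℂ] H) := Complex.hasSum_re (h T)
  refine ⟨{ toFun T := (opTrace (T * ρ)).re, map_add' := fun S T => ?_, map_smul' := fun c T => ?_ },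
    fun _ => rfl, fun T => ?_, ?_⟩
  · refine (hre (S + T)).unique ?_
    convert (hre S).add (hre T) using 1
    funext i
    simp
  · refine (hre (c • T)).unique ?_
    have hc : (fun i => (⟪v i, (c • T) (v i)⟫_ℂ).re) = fun i => c * (⟪v i, T (v i)⟫_ℂ).re := by
      funext i
      rw [smul_apply, inner_smul_right_eq_smul, Complex.smul_re, smul_eq_mul]
    rw [hc]
    exact (hre T).mul_left c
  · have h2 := hv.mul_left ‖T‖
    rw [mul_one] at h2
    refine hasSum_le (fun i => ?_) (hre T) h2
    calc _ ≤ ‖⟪v i, T (v i)⟫_ℂ‖ := Complex.re_le_norm _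
      _ ≤ ‖v i‖ * (‖T‖ * ‖v i‖) := (norm_inner_le_norm _ _).trans (by
          gcongr; exact T.le_opNorm _)
      _ = _ := by ring
  · refine (hre 1).unique ?_
    convert hv using 1
    funext i
    rw [one_apply_eq_self, inner_self_eq_norm_sq_to_K]
    norm_cast

end Trace

/-! ### Norm bounds for anticommuting contractions and for POVM differences. -/

section Anticommuting

variable {H : Type*} [NormedAddCommGroup H] [InnerProductSpace ℂ H]

/-- Real combinations of two anticommuting symmetric contractions. -/
theorem norm_smul_add_smul_le_of_anticommute {S T : H →L[ℂ] H}
    (hS : ∀ x y, ⟪S x, y⟫_ℂ = ⟪x, S y⟫_ℂ) (hT : ∀ x y, ⟪T x, y⟫_ℂ = ⟪x, T y⟫_ℂ)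
    (hST : S * T + T * S = 0) (hS1 : ‖S‖ ≤ 1) (hT1 : ‖T‖ ≤ 1) (a b : ℝ) :
    ‖a • S + b • T‖ ≤ √(a ^ 2 + b ^ 2) := by
  refine ContinuousLinearMap.opNorm_le_bound _ (Real.sqrt_nonneg _) fun v => ?_
  -- Anticommutation makes `S v` and `T v` orthogonal in the real sense, so Pythagoras applies.
  have hre : RCLike.re ⟪S v, T v⟫_ℂ = 0 := by
    have h : ⟪S v, T v⟫_ℂ + ⟪T v, S v⟫_ℂ = 0 := by
      rw [hS, hT, ← inner_add_right]
      have := congrArg (fun R : H →L[ℂ] H => R v) hST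
      simp only [add_apply, mul_apply_eq_comp,
        zero_apply] at this
      rw [this, inner_zero_right]
    have h' := congrArg RCLike.re h
    rw [map_add, inner_re_symm (T v), map_zero] at h'
    linarith
  have hSv : ‖S v‖ ^ 2 ≤ ‖v‖ ^ 2 := by
    gcongr; exact S.le_of_opNorm_le_of_le hS1 le_rfl |>.trans_eq (one_mul _)
  have hTv : ‖T v‖ ^ 2 ≤ ‖v‖ ^ 2 := by
    gcongr; exact T.le_of_opNorm_le_of_le hT1 le_rfl |>.trans_eq (one_mul _)
  have hn : ‖(a • S + b • T) v‖ ^ 2 = a ^ 2 * ‖S v‖ ^ 2 + b ^ 2 * ‖T v‖ ^ 2 := by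
    have h : RCLike.re ⟪a • S v, b • T v⟫_ℂ = 0 := by
      rw [inner_smul_left_eq_smul, inner_smul_right_eq_smul]
      simp only [RCLike.smul_re]
      rw [hre]; simp
    rw [add_apply, smul_apply,
      smul_apply, @norm_add_sq ℂ, h, norm_smul, norm_smul]
    simp [mul_pow]
  refine abs_le_of_sq_le_sq' ?_ (by positivity) |>.2
  rw [mul_pow, Real.sq_sqrt (by positivity), hn]
  nlinarith [mul_le_mul_of_nonneg_left hSv (sq_nonneg a),
    mul_le_mul_of_nonneg_left hTv (sq_nonneg b)]

/-- With `P + R = 1` the effects commute, and `‖v‖² - ‖(P - R) v‖² = 4 Re ⟪P v, R v⟫`. The last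
inner product equals `⟪P v, R P v⟫ + ⟪R v, P R v⟫`, a sum of nonnegative terms, so neither square
roots nor completeness are needed. -/
theorem BinaryPOVM.norm_sub_le_one (M : BinaryPOVM H) : ‖M.effect 0 - M.effect 1‖ ≤ 1 := by
  refine ContinuousLinearMap.opNorm_le_bound _ zero_le_one fun v => ?_
  rw [one_mul]
  set P := M.effect 0
  set R := M.effect 1
  have hs (x : H) : P x + R x = x := congrArg (fun T : H →L[ℂ] H => T x) M.sum_eq_one
  have hPs (x y : H) : ⟪P x, y⟫_ℂ = ⟪x, P y⟫_ℂ := (M.isPositive 0).isSymmetric x y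
  have hRs (x y : H) : ⟪R x, y⟫_ℂ = ⟪x, R y⟫_ℂ := (M.isPositive 1).isSymmetric x y
  have h1 : 0 ≤ RCLike.re ⟪P v, R (P v)⟫_ℂ := (M.isPositive 1).re_inner_nonneg_right _
  have h2 : 0 ≤ RCLike.re ⟪R v, P (R v)⟫_ℂ := (M.isPositive 0).re_inner_nonneg_right _
  have hcomm : P (R v) = R (P v) := by
    have e1 := hs (P v)
    have e2 := congrArg P (hs v)
    rw [map_add] at e2
    exact add_left_cancel (e2.trans e1.symm)
  have h3 : ⟪P v, R v⟫_ℂ = ⟪P v, R (P v)⟫_ℂ + ⟪R v, P (R v)⟫_ℂ := by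
    rw [← hPs (R v) (R v), hcomm, hRs (P v) (R v), ← hcomm,
      ← inner_add_right, hs]
  have h4 : ‖P v + R v‖ ^ 2 = ‖v‖ ^ 2 := by rw [hs]
  rw [@norm_add_sq ℂ, h3, map_add] at h4
  refine abs_le_of_sq_le_sq' ?_ (norm_nonneg _) |>.2
  rw [sub_apply, @norm_sub_sq ℂ, h3, map_add]
  linarith

end Anticommuting

/-! ### Algebra, norm and symmetry of `tensorOp`, by density of the algebraic tensors. -/

section TensorOp

variable {E₁ E₂ : Type*}
  [NormedAddCommGroup E₁] [InnerProductSpace ℂ E₁]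
  [NormedAddCommGroup E₂] [InnerProductSpace ℂ E₂]

theorem tensorOp_ofAlgebraic (A : Qubit →L[ℂ] Qubit) (B : E₁ →L[ℂ] E₁) (C : E₂ →L[ℂ] E₂)
    (t : Qubit ⊗[ℂ] (E₁ ⊗[ℂ] E₂)) :
    tensorOp A B C (ofAlgebraic t) =
      ofAlgebraic (TensorProduct.mapL A (TensorProduct.mapL B C) t) :=
  ContinuousLinearMap.completion_apply_coe _ _

theorem continuousLinearMap_ext_ofAlgebraic {S T : Tripartite E₁ E₂ →L[ℂ] Tripartite E₁ E₂}
    (h : ∀ t, S (ofAlgebraic t) = T (ofAlgebraic t)) : S = T :=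
  ContinuousLinearMap.ext fun x =>
    congrFun (denseRange_ofAlgebraic.equalizer S.continuous T.continuous (funext h)) x

theorem ofAlgebraic_add (s t : Qubit ⊗[ℂ] (E₁ ⊗[ℂ] E₂)) :
    ofAlgebraic (s + t) = ofAlgebraic s + ofAlgebraic t :=
  UniformSpace.Completion.coe_add s t

theorem norm_ofAlgebraic (t : Qubit ⊗[ℂ] (E₁ ⊗[ℂ] E₂)) : ‖ofAlgebraic t‖ = ‖t‖ :=
  UniformSpace.Completion.norm_coe t

theorem tensorOp_add_left (A A' : Qubit →L[ℂ] Qubit) (B : E₁ →L[ℂ] E₁) (C : E₂ →L[ℂ] E₂) :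
    tensorOp (A + A') B C = tensorOp A B C + tensorOp A' B C :=
  continuousLinearMap_ext_ofAlgebraic fun t => by
    simp only [tensorOp_ofAlgebraic, add_apply, TensorProduct.mapL_add_left, ofAlgebraic_add]

theorem tensorOp_add_middle (A : Qubit →L[ℂ] Qubit) (B B' : E₁ →L[ℂ] E₁) (C : E₂ →L[ℂ] E₂) :
    tensorOp A (B + B') C = tensorOp A B C + tensorOp A B' C :=
  continuousLinearMap_ext_ofAlgebraic fun t => by
    simp only [tensorOp_ofAlgebraic, add_apply, TensorProduct.mapL_add_left,
      TensorProduct.mapL_add_right, ofAlgebraic_add]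

theorem tensorOp_add_right (A : Qubit →L[ℂ] Qubit) (B : E₁ →L[ℂ] E₁) (C C' : E₂ →L[ℂ] E₂) :
    tensorOp A B (C + C') = tensorOp A B C + tensorOp A B C' :=
  continuousLinearMap_ext_ofAlgebraic fun t => by
    simp only [tensorOp_ofAlgebraic, add_apply, TensorProduct.mapL_add_right, ofAlgebraic_add]

theorem tensorOp_zero_left (B : E₁ →L[ℂ] E₁) (C : E₂ →L[ℂ] E₂) : tensorOp 0 B C = 0 := by
  have h := tensorOp_add_left 0 0 B C
  rwa [add_zero, left_eq_add] at h

theorem tensorOp_zero_middle (A : Qubit →L[ℂ] Qubit) (C : E₂ →L[ℂ] E₂) :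
    tensorOp A (0 : E₁ →L[ℂ] E₁) C = 0 := by
  have h := tensorOp_add_middle A (0 : E₁ →L[ℂ] E₁) 0 C
  rwa [add_zero, left_eq_add] at h

theorem tensorOp_zero_right (A : Qubit →L[ℂ] Qubit) (B : E₁ →L[ℂ] E₁) :
    tensorOp A B (0 : E₂ →L[ℂ] E₂) = 0 := by
  have h := tensorOp_add_right A B (0 : E₂ →L[ℂ] E₂) 0
  rwa [add_zero, left_eq_add] at h

theorem tensorOp_sub_left (A A' : Qubit →L[ℂ] Qubit) (B : E₁ →L[ℂ] E₁) (C : E₂ →L[ℂ] E₂) :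
    tensorOp (A - A') B C = tensorOp A B C - tensorOp A' B C := by
  rw [eq_sub_iff_add_eq, ← tensorOp_add_left, sub_add_cancel]

theorem tensorOp_sub_middle (A : Qubit →L[ℂ] Qubit) (B B' : E₁ →L[ℂ] E₁) (C : E₂ →L[ℂ] E₂) :
    tensorOp A (B - B') C = tensorOp A B C - tensorOp A B' C := by
  rw [eq_sub_iff_add_eq, ← tensorOp_add_middle, sub_add_cancel]

theorem tensorOp_sub_right (A : Qubit →L[ℂ] Qubit) (B : E₁ →L[ℂ] E₁) (C C' : E₂ →L[ℂ] E₂) :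
    tensorOp A B (C - C') = tensorOp A B C - tensorOp A B C' := by
  rw [eq_sub_iff_add_eq, ← tensorOp_add_right, sub_add_cancel]

theorem tensorOp_mul (A A' : Qubit →L[ℂ] Qubit) (B B' : E₁ →L[ℂ] E₁) (C C' : E₂ →L[ℂ] E₂) :
    tensorOp (A * A') (B * B') (C * C') = tensorOp A B C * tensorOp A' B' C' :=
  continuousLinearMap_ext_ofAlgebraic fun t => by
    simp only [tensorOp_ofAlgebraic, mul_apply_eq_comp, TensorProduct.mapL_mul]

theorem tensorOp_one :
    tensorOp (1 : Qubit →L[ℂ] Qubit) (1 : E₁ →L[ℂ] E₁) (1 : E₂ →L[ℂ] E₂) = 1 :=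
  continuousLinearMap_ext_ofAlgebraic fun t => by
    have h : TensorProduct.mapL (1 : Qubit →L[ℂ] Qubit)
        (TensorProduct.mapL (1 : E₁ →L[ℂ] E₁) (1 : E₂ →L[ℂ] E₂)) = .id ℂ _ := by
      simp only [ContinuousLinearMap.one_def, TensorProduct.mapL_id_id]
    rw [tensorOp_ofAlgebraic, h]
    rfl

theorem norm_tensorOp_le (A : Qubit →L[ℂ] Qubit) (B : E₁ →L[ℂ] E₁) (C : E₂ →L[ℂ] E₂) :
    ‖tensorOp A B C‖ ≤ ‖A‖ * (‖B‖ * ‖C‖) := by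
  refine ContinuousLinearMap.opNorm_le_bound _ (by positivity) fun x => ?_
  refine denseRange_ofAlgebraic.induction_on x
    (isClosed_le (by fun_prop) (by fun_prop)) fun t => ?_
  rw [tensorOp_ofAlgebraic, norm_ofAlgebraic, norm_ofAlgebraic]
  refine ContinuousLinearMap.le_of_opNorm_le _ ((TensorProduct.norm_mapL_le _ _).trans ?_) t
  gcongr
  exact TensorProduct.norm_mapL_le _ _

theorem inner_mapL_left_eq_right {E F : Type*} [NormedAddCommGroup E] [InnerProductSpace ℂ E]
    [NormedAddCommGroup F] [InnerProductSpace ℂ F] {A : E →L[ℂ] E} {B : F →L[ℂ] F}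
    (hA : ∀ x y, ⟪A x, y⟫_ℂ = ⟪x, A y⟫_ℂ) (hB : ∀ x y, ⟪B x, y⟫_ℂ = ⟪x, B y⟫_ℂ)
    (s t : E ⊗[ℂ] F) :
    ⟪TensorProduct.mapL A B s, t⟫_ℂ = ⟪s, TensorProduct.mapL A B t⟫_ℂ := by
  induction s using TensorProduct.induction_on with
  | zero => simp only [map_zero, inner_zero_left]
  | add s s' hs hs' => simp only [map_add, inner_add_left, hs, hs']
  | tmul x y =>
    induction t using TensorProduct.induction_on with
    | zero => simp only [map_zero, inner_zero_right]
    | add t t' ht ht' => simp only [map_add, inner_add_right, ht, ht']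
    | tmul x' y' =>
      simp only [TensorProduct.mapL_tmul, TensorProduct.inner_tmul, hA, hB]

theorem inner_tensorOp_left_eq_right {A : Qubit →L[ℂ] Qubit} {B : E₁ →L[ℂ] E₁}
    {C : E₂ →L[ℂ] E₂} (hA : ∀ x y, ⟪A x, y⟫_ℂ = ⟪x, A y⟫_ℂ)
    (hB : ∀ x y, ⟪B x, y⟫_ℂ = ⟪x, B y⟫_ℂ) (hC : ∀ x y, ⟪C x, y⟫_ℂ = ⟪x, C y⟫_ℂ)
    (x y : Tripartite E₁ E₂) : ⟪tensorOp A B C x, y⟫_ℂ = ⟪x, tensorOp A B C y⟫_ℂ := by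
  refine denseRange_ofAlgebraic.induction_on₂ (p := fun x y =>
    ⟪tensorOp A B C x, y⟫_ℂ = ⟪x, tensorOp A B C y⟫_ℂ)
    (isClosed_eq (by fun_prop) (by fun_prop)) (fun s t => ?_) x y
  rw [tensorOp_ofAlgebraic, tensorOp_ofAlgebraic, inner_ofAlgebraic, inner_ofAlgebraic]
  exact inner_mapL_left_eq_right hA (inner_mapL_left_eq_right hB hC) s t

end TensorOp

/-! ### Qubit observables of the which-path and which-phase bases. -/

section Qubit

/-- The observable `|x₀⟩⟨x₀| - |x₁⟩⟨x₁|` with values `±1`. -/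
def basisObservable (X : Fin 2 → Qubit) : Qubit →L[ℂ] Qubit := ketbra (X 0) - ketbra (X 1)

theorem ketbra_apply (x y : Qubit) : ketbra x y = ⟪x, y⟫_ℂ • x := rfl

theorem inner_basisObservable_left_eq_right (X : Fin 2 → Qubit) (x y : Qubit) :
    ⟪basisObservable X x, y⟫_ℂ = ⟪x, basisObservable X y⟫_ℂ := by
  simp only [basisObservable, sub_apply, ketbra_apply, inner_sub_left, inner_sub_right,
    inner_smul_left, inner_smul_right, inner_conj_symm]
  ring

theorem basisObservable_whichPath_apply (v : Qubit) :
    basisObservable whichPath v = !₂[v 0, -v 1] := by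
  ext i
  fin_cases i <;> simp [basisObservable, ketbra_apply, whichPath, EuclideanSpace.inner_single_left]

theorem ketbra_whichPath_add : ketbra (whichPath 0) + ketbra (whichPath 1) = 1 := by
  ext v i
  fin_cases i <;> simp [ketbra_apply, whichPath, EuclideanSpace.inner_single_left]

theorem exp_neg_mul_exp_I (φ : ℝ) :
    Complex.exp (-(Complex.I * φ)) * Complex.exp (Complex.I * φ) = 1 := by
  rw [← Complex.exp_add, neg_add_cancel, Complex.exp_zero]

theorem conj_exp_I_mul (φ : ℝ) :
    (starRingEnd ℂ) (Complex.exp (Complex.I * φ)) = Complex.exp (-(Complex.I * φ)) := by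
  rw [← Complex.exp_conj]
  simp

theorem ketbra_whichPhase_apply (φ : ℝ) (j : Fin 2) (v : Qubit) :
    ketbra (whichPhase φ j) v =
      !₂[(v 0 + (-1) ^ (j : ℕ) * Complex.exp (-(Complex.I * φ)) * v 1) / 2,
        ((-1) ^ (j : ℕ) * Complex.exp (Complex.I * φ) * v 0 + v 1) / 2] := by
  have h2 : ((√2 : ℝ) : ℂ)⁻¹ * ((√2 : ℝ) : ℂ)⁻¹ = 1 / 2 := by
    rw [← mul_inv]; norm_cast; norm_num
  have hin : ⟪whichPhase φ j, v⟫_ℂ = ((√2 : ℝ) : ℂ)⁻¹ *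
      (v 0 + (-1) ^ (j : ℕ) * Complex.exp (-(Complex.I * φ)) * v 1) := by
    simp only [whichPhase, inner_smul_left, inner_add_left, whichPath,
      EuclideanSpace.inner_single_left, map_mul, conj_exp_I_mul]
    simp
  have hs : ((-1 : ℂ) ^ (j : ℕ)) * (-1) ^ (j : ℕ) = 1 := by
    rw [← mul_pow]; simp
  have he := exp_neg_mul_exp_I φ
  rw [ketbra_apply, hin]
  ext i
  fin_cases i
  · simp [whichPhase, whichPath]
    linear_combination (v 0 + (-1) ^ (j : ℕ) * Complex.exp (-(Complex.I * φ)) * v 1) * h2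
  · simp [whichPhase, whichPath]
    linear_combination (v 0 + (-1) ^ (j : ℕ) * Complex.exp (-(Complex.I * φ)) * v 1) *
        ((-1) ^ (j : ℕ) * Complex.exp (Complex.I * φ)) * h2 +
      v 1 / 2 * (he * ((-1) ^ (j : ℕ) * (-1) ^ (j : ℕ)) + hs)

theorem basisObservable_whichPhase_apply (φ : ℝ) (v : Qubit) :
    basisObservable (whichPhase φ) v =
      !₂[Complex.exp (-(Complex.I * φ)) * v 1, Complex.exp (Complex.I * φ) * v 0] := by
  ext i
  fin_cases i <;> simp [basisObservable, ketbra_whichPhase_apply] <;> ring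

theorem ketbra_whichPhase_add (φ : ℝ) :
    ketbra (whichPhase φ 0) + ketbra (whichPhase φ 1) = 1 := by
  ext v i
  fin_cases i <;> simp [ketbra_whichPhase_apply] <;> ring

theorem norm_le_one_of_mul_self_eq_one {H : Type*} [NormedAddCommGroup H] [InnerProductSpace ℂ H]
    {S : H →L[ℂ] H} (hS : ∀ x y, ⟪S x, y⟫_ℂ = ⟪x, S y⟫_ℂ) (h1 : S * S = 1) : ‖S‖ ≤ 1 := by
  refine ContinuousLinearMap.opNorm_le_bound _ zero_le_one fun v => ?_
  have h : S (S v) = v := congrArg (fun T : H →L[ℂ] H => T v) h1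
  rw [one_mul, norm_eq_sqrt_re_inner (𝕜 := ℂ), hS, h, ← norm_eq_sqrt_re_inner]

theorem norm_basisObservable_whichPath_le : ‖basisObservable whichPath‖ ≤ 1 := by
  refine norm_le_one_of_mul_self_eq_one (inner_basisObservable_left_eq_right _) ?_
  ext v i
  fin_cases i <;> simp [mul_apply_eq_comp, basisObservable_whichPath_apply]

theorem norm_basisObservable_whichPhase_le (φ : ℝ) : ‖basisObservable (whichPhase φ)‖ ≤ 1 := by
  refine norm_le_one_of_mul_self_eq_one (inner_basisObservable_left_eq_right _) ?_
  have he := exp_neg_mul_exp_I φ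
  ext v i
  fin_cases i
  · simp [mul_apply_eq_comp, basisObservable_whichPhase_apply]
    linear_combination v 0 * he
  · simp [mul_apply_eq_comp, basisObservable_whichPhase_apply]
    linear_combination v 1 * he

theorem basisObservable_anticommute (φ : ℝ) :
    basisObservable whichPath * basisObservable (whichPhase φ) +
      basisObservable (whichPhase φ) * basisObservable whichPath = 0 := by
  ext v i
  fin_cases i <;>
    simp [mul_apply_eq_comp, basisObservable_whichPhase_apply, basisObservable_whichPath_apply]

theorem continuous_basisObservable_whichPhase :
    Continuous fun φ => basisObservable (whichPhase φ) := by
  have h (j : Fin 2) : Continuous fun φ => whichPhase φ j := by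
    unfold whichPhase
    fun_prop
  have hk : Continuous ketbra := by
    refine continuous_clm_apply.mpr fun v => ?_
    simp only [ketbra_apply]
    fun_prop
  exact (hk.comp (h 0)).sub (hk.comp (h 1))

theorem whichPhase_periodic : Function.Periodic whichPhase (2 * Real.pi) := by
  intro φ
  funext j
  have h : Complex.exp (Complex.I * ((φ + 2 * Real.pi : ℝ) : ℂ)) =
      Complex.exp (Complex.I * φ) := by
    rw [← Complex.exp_periodic (Complex.I * φ)]
    congr 1
    push_cast
    ring
  simp only [whichPhase, h]

end Qubit

/-! ### Guessing probabilities as suprema of expectation values. -/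

section Guessing

/-- The measurement that tosses a fair coin. -/
def BinaryPOVM.coin (E : Type*) [NormedAddCommGroup E] [InnerProductSpace ℂ E] :
    BinaryPOVM E where
  effect _ := ((1 / 2 : ℝ) : ℂ) • 1
  isPositive _ := by
    refine ContinuousLinearMap.isPositive_one.smul_of_nonneg ?_
    norm_cast
    norm_num
  sum_eq_one := by
    rw [← add_smul]
    norm_num

instance (E : Type*) [NormedAddCommGroup E] [InnerProductSpace ℂ E] : Nonempty (BinaryPOVM E) :=
  ⟨.coin E⟩

variable {E₁ E₂ : Type*}
  [NormedAddCommGroup E₁] [InnerProductSpace ℂ E₁]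
  [NormedAddCommGroup E₂] [InnerProductSpace ℂ E₂]

theorem inner_effect_sub_left_eq_right {E : Type*} [NormedAddCommGroup E] [InnerProductSpace ℂ E]
    (M : BinaryPOVM E) (x y : E) :
    ⟪(M.effect 0 - M.effect 1) x, y⟫_ℂ = ⟪x, (M.effect 0 - M.effect 1) y⟫_ℂ := by
  have h (j : Fin 2) : ⟪M.effect j x, y⟫_ℂ = ⟪x, M.effect j y⟫_ℂ :=
    (M.isPositive j).isSymmetric x y
  simp only [sub_apply, inner_sub_left, inner_sub_right, h]

/-- Both sides are the probability of a right guess minus that of a wrong one: the two resolutions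
of the identity split `ω 1 = 1` into four joint outcomes. -/
theorem two_mul_winProb₁_sub_one {ρ : Tripartite E₁ E₂ →L[ℂ] Tripartite E₁ E₂}
    {ω : (Tripartite E₁ E₂ →L[ℂ] Tripartite E₁ E₂) →ₗ[ℝ] ℝ}
    (hω : ∀ T, (opTrace (T * ρ)).re = ω T) (hω1 : ω 1 = 1) {X : Fin 2 → Qubit}
    (hX : ketbra (X 0) + ketbra (X 1) = 1) (M : BinaryPOVM E₁) :
    2 * winProb₁ ρ X M - 1 =
      ω (tensorOp (basisObservable X) (M.effect 0 - M.effect 1) 1) := by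
  have h1 := hω1
  rw [← tensorOp_one, ← hX, ← M.sum_eq_one] at h1
  simp only [tensorOp_add_left, tensorOp_add_middle, map_add] at h1
  simp only [winProb₁, Fin.sum_univ_two, hω, basisObservable, tensorOp_sub_left,
    tensorOp_sub_middle, map_sub]
  linarith

theorem two_mul_winProb₂_sub_one {ρ : Tripartite E₁ E₂ →L[ℂ] Tripartite E₁ E₂}
    {ω : (Tripartite E₁ E₂ →L[ℂ] Tripartite E₁ E₂) →ₗ[ℝ] ℝ}
    (hω : ∀ T, (opTrace (T * ρ)).re = ω T) (hω1 : ω 1 = 1) {X : Fin 2 → Qubit}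
    (hX : ketbra (X 0) + ketbra (X 1) = 1) (M : BinaryPOVM E₂) :
    2 * winProb₂ ρ X M - 1 =
      ω (tensorOp (basisObservable X) 1 (M.effect 0 - M.effect 1)) := by
  have h1 := hω1
  rw [← tensorOp_one, ← hX, ← M.sum_eq_one] at h1
  simp only [tensorOp_add_left, tensorOp_add_right, map_add] at h1
  simp only [winProb₂, Fin.sum_univ_two, hω, basisObservable, tensorOp_sub_left,
    tensorOp_sub_right, map_sub]
  linarith

theorem norm_tensorOp_middle_le (A : Qubit →L[ℂ] Qubit) (M : BinaryPOVM E₁) :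
    ‖tensorOp A (M.effect 0 - M.effect 1) (1 : E₂ →L[ℂ] E₂)‖ ≤ ‖A‖ :=
  (norm_tensorOp_le _ _ _).trans <| mul_le_of_le_one_right (norm_nonneg _) <|
    mul_le_one₀ M.norm_sub_le_one (norm_nonneg _) ContinuousLinearMap.norm_id_le

theorem norm_tensorOp_right_le (A : Qubit →L[ℂ] Qubit) (M : BinaryPOVM E₂) :
    ‖tensorOp A (1 : E₁ →L[ℂ] E₁) (M.effect 0 - M.effect 1)‖ ≤ ‖A‖ :=
  (norm_tensorOp_le _ _ _).trans <| mul_le_of_le_one_right (norm_nonneg _) <|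
    mul_le_one₀ ContinuousLinearMap.norm_id_le (norm_nonneg _) M.norm_sub_le_one

/-- `2 sup p - 1 = sup (2 p - 1)` for a nonempty family that is bounded above. -/
theorem isLUB_two_mul_iSup_sub_one {ι : Type*} [Nonempty ι] {p f : ι → ℝ} {c : ℝ}
    (hf : ∀ i, 2 * p i - 1 = f i) (hc : ∀ i, f i ≤ c) :
    IsLUB (Set.range f) (2 * (⨆ i, p i) - 1) := by
  have hbdd : BddAbove (Set.range p) :=
    ⟨(c + 1) / 2, by rintro _ ⟨i, rfl⟩; linarith [hf i, hc i]⟩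
  constructor
  · rintro _ ⟨i, rfl⟩
    linarith [hf i, le_ciSup hbdd i]
  · intro b hb
    have h : (⨆ i, p i) ≤ (b + 1) / 2 :=
      ciSup_le fun i => by linarith [hf i, hb ⟨i, rfl⟩]
    linarith

/-- The distinguishability is the best bias of a guess of the path. -/
theorem isLUB_distinguishability {ρ : Tripartite E₁ E₂ →L[ℂ] Tripartite E₁ E₂}
    {ω : (Tripartite E₁ E₂ →L[ℂ] Tripartite E₁ E₂) →ₗ[ℝ] ℝ}
    (hω : ∀ T, (opTrace (T * ρ)).re = ω T) (hω1 : ω 1 = 1) (hωn : ∀ T, ω T ≤ ‖T‖) :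
    IsLUB (Set.range fun M : BinaryPOVM E₁ =>
        ω (tensorOp (basisObservable whichPath) (M.effect 0 - M.effect 1) 1))
      (distinguishability ρ) :=
  isLUB_two_mul_iSup_sub_one
    (fun M => two_mul_winProb₁_sub_one hω hω1 ketbra_whichPath_add M)
    fun M => (hωn _).trans (norm_tensorOp_middle_le _ M)

theorem isLUB_two_mul_pGuess₂_sub_one {ρ : Tripartite E₁ E₂ →L[ℂ] Tripartite E₁ E₂}
    {ω : (Tripartite E₁ E₂ →L[ℂ] Tripartite E₁ E₂) →ₗ[ℝ] ℝ}
    (hω : ∀ T, (opTrace (T * ρ)).re = ω T) (hω1 : ω 1 = 1) (hωn : ∀ T, ω T ≤ ‖T‖) (φ : ℝ) :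
    IsLUB (Set.range fun M : BinaryPOVM E₂ =>
        ω (tensorOp (basisObservable (whichPhase φ)) 1 (M.effect 0 - M.effect 1)))
      (2 * pGuess₂ ρ (whichPhase φ) - 1) :=
  isLUB_two_mul_iSup_sub_one
    (fun M => two_mul_winProb₂_sub_one hω hω1 (ketbra_whichPhase_add φ) M)
    fun M => (hωn _).trans (norm_tensorOp_right_le _ M)

/-- For each POVM the bias is 1-Lipschitz in the qubit observable; the constant does not depend on
the POVM, so the supremum is 1-Lipschitz too. -/
theorem continuous_two_mul_pGuess₂_sub_one {ρ : Tripartite E₁ E₂ →L[ℂ] Tripartite E₁ E₂}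
    (hρ : IsDensityOperator ρ) : Continuous fun φ => 2 * pGuess₂ ρ (whichPhase φ) - 1 := by
  obtain ⟨ω, hω, hωn, hω1⟩ := hρ.exists_state
  have hle (φ ψ : ℝ) : 2 * pGuess₂ ρ (whichPhase φ) - 1 ≤ 2 * pGuess₂ ρ (whichPhase ψ) - 1 +
      ‖basisObservable (whichPhase φ) - basisObservable (whichPhase ψ)‖ := by
    refine (isLUB_two_mul_pGuess₂_sub_one hω hω1 hωn φ).2 ?_
    rintro _ ⟨M, rfl⟩
    have h1 := (isLUB_two_mul_pGuess₂_sub_one hω hω1 hωn ψ).1 ⟨M, rfl⟩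
    have h2 := (hωn _).trans (norm_tensorOp_right_le (E₁ := E₁)
      (basisObservable (whichPhase φ) - basisObservable (whichPhase ψ)) M)
    rw [tensorOp_sub_left, map_sub] at h2
    dsimp only at h1 ⊢
    linarith
  refine continuous_iff_continuousAt.mpr fun ψ => ?_
  rw [ContinuousAt, tendsto_iff_norm_sub_tendsto_zero]
  have h0 := tendsto_iff_norm_sub_tendsto_zero.mp
    (continuous_basisObservable_whichPhase.tendsto ψ)
  refine squeeze_zero (fun _ => norm_nonneg _) (fun φ => ?_) h0
  rw [Real.norm_eq_abs, abs_sub_le_iff]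
  have h1 := hle φ ψ
  have h2 := hle ψ φ
  rw [norm_sub_rev] at h2
  constructor <;> linarith

end Guessing

end WaveParticle

end

/-! ### The duality relation. -/

theorem mainTheorem3 {E₁ E₂ : Type*}
    [NormedAddCommGroup E₁] [InnerProductSpace ℂ E₁] [CompleteSpace E₁]
    [NormedAddCommGroup E₂] [InnerProductSpace ℂ E₂] [CompleteSpace E₂]
    (ρ : WaveParticle.Tripartite E₁ E₂ →L[ℂ] WaveParticle.Tripartite E₁ E₂)
    (hρ : WaveParticle.IsDensityOperator ρ) :
    IsGreatest
        (Set.range fun φ₀ : ℝ =>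
          2 * WaveParticle.pGuess₂ ρ (WaveParticle.whichPhase φ₀) - 1)
        (WaveParticle.visibility ρ) ∧
      WaveParticle.distinguishability ρ ^ 2 + WaveParticle.visibility ρ ^ 2 ≤ 1 := by
  open WaveParticle in
  set g : ℝ → ℝ := fun φ => 2 * pGuess₂ ρ (whichPhase φ) - 1 with hg
  have hper : Function.Periodic g (2 * Real.pi) := fun φ => by
    simp only [hg, whichPhase_periodic φ]
  have hcpt : IsCompact (Set.range g) :=
    hper.compact_of_continuous Real.two_pi_pos.ne' (continuous_two_mul_pGuess₂_sub_one hρ)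
  have hV : IsGreatest (Set.range g) (visibility ρ) :=
    ⟨hcpt.sSup_mem (Set.range_nonempty g), fun _ hx => le_csSup hcpt.bddAbove hx⟩
  refine ⟨hV, ?_⟩
  obtain ⟨ω, hω, hωn, hω1⟩ := hρ.exists_state
  have hD := isLUB_distinguishability hω hω1 hωn
  obtain ⟨φ, hφ⟩ := hV.1
  have hVφ := isLUB_two_mul_pGuess₂_sub_one hω hω1 hωn φ
  change 2 * pGuess₂ ρ (whichPhase φ) - 1 = visibility ρ at hφ
  rw [hφ] at hVφ
  -- The fair coin has bias zero. Nonnegativity is needed to use `D` and `V` themselves as the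
  -- weights `a` and `b`.
  have hD0 : 0 ≤ distinguishability ρ := hD.1 ⟨.coin E₁, by
    simp only [BinaryPOVM.coin, sub_self, tensorOp_zero_middle, map_zero]⟩
  have hV0 : 0 ≤ visibility ρ := hVφ.1 ⟨.coin E₂, by
    simp only [BinaryPOVM.coin, sub_self, tensorOp_zero_right, map_zero]⟩
  have key (a b : ℝ) (M : BinaryPOVM E₁) (N : BinaryPOVM E₂) :
      a * ω (tensorOp (basisObservable whichPath) (M.effect 0 - M.effect 1) 1) +
        b * ω (tensorOp (basisObservable (whichPhase φ)) 1 (N.effect 0 - N.effect 1)) ≤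
      √(a ^ 2 + b ^ 2) := by
    rw [← smul_eq_mul, ← smul_eq_mul, ← map_smul, ← map_smul, ← map_add]
    refine (hωn _).trans (norm_smul_add_smul_le_of_anticommute
      (inner_tensorOp_left_eq_right (inner_basisObservable_left_eq_right _)
        (inner_effect_sub_left_eq_right M) fun _ _ => rfl)
      (inner_tensorOp_left_eq_right (inner_basisObservable_left_eq_right _)
        (fun _ _ => rfl) (inner_effect_sub_left_eq_right N)) ?_
      ((norm_tensorOp_middle_le _ M).trans norm_basisObservable_whichPath_le)
      ((norm_tensorOp_right_le _ N).trans (norm_basisObservable_whichPhase_le φ)) a b)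
    -- Since `M` and `N` sit in different factors, `S T + T S = (Z W + W Z) ⊗ (M₀ - M₁) ⊗ (N₀ -
    -- N₁)`.
    rw [← tensorOp_mul, ← tensorOp_mul, one_mul, one_mul, mul_one, mul_one, ← tensorOp_add_left,
      basisObservable_anticommute, tensorOp_zero_left]
  have hle : ∀ a b : ℝ, 0 ≤ a → 0 ≤ b →
      a * distinguishability ρ + b * visibility ρ ≤ √(a ^ 2 + b ^ 2) := by
    intro a b ha hb
    refine le_of_forall_pos_le_add fun ε hε => ?_
    -- Near-optimal POVMs lose at most `(a + b) δ ≤ ε`; the `+ 1` covers `a = b = 0`.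
    have hδ : 0 < ε / (a + b + 1) := by positivity
    obtain ⟨_, ⟨M, rfl⟩, hM, -⟩ := hD.exists_between (sub_lt_self _ hδ)
    obtain ⟨_, ⟨N, rfl⟩, hN, -⟩ := hVφ.exists_between (sub_lt_self _ hδ)
    have h1 := mul_le_mul_of_nonneg_left hM.le ha
    have h2 := mul_le_mul_of_nonneg_left hN.le hb
    have h3 : (a + b) * (ε / (a + b + 1)) ≤ ε := by
      rw [mul_div_assoc', div_le_iff₀ (by positivity)]
      nlinarith
    linarith [key a b M N]
  have h := hle _ _ hD0 hV0
  have hs := Real.sq_sqrt (by positivity :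
    0 ≤ distinguishability ρ ^ 2 + visibility ρ ^ 2)
  -- With `r = √(D² + V²)`, `h` says `r² ≤ r`, which forces `r ≤ 1`.
  nlinarith [Real.sqrt_nonneg (distinguishability ρ ^ 2 + visibility ρ ^ 2)]
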